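/- All graphs are finite, simple and undirected. A graph $G$ of order $n$ is $m$-connected if $n>m$ and $G-X$ is connected for every $X\subseteq V(G)$ with $|X|<m$. For a connected graph $G$, $\mu_1(G)$ denotes the distance spectral radius, i.e. the largest eigenvalue of the distance matrix $D(G)=(d_G(u,v))_{u,v\in V(G)}$. For $b$ odd, a $[1,b]$-odd factor of a graph is a spanning subgraph $H$ with $d_H(v)\in\{1,3,\ldots,b\}$ for every vertex $v$. For $k\ge 1$, a graph $G$ of order $n\ge k+2$ is $k$-critical with respect to $[1,b]$-odd factors if $G-X$ contains a $[1,b]$-odd factor for every $X\subseteq V(G)$ with $|X|=k$. $K_m$ is the complete graph on $m$ vertices, $\cup$ is disjoint union, $tK_1$ is the graph with $t$ vertices and no edges, and $\vee$ is the join. Theorem 1.5. Let $b$, $k$ and $n$ be positive integers with $n\equiv k \pmod 2$ and $b\equiv 1\pmod 2$, and let $G$ be a $(k+1)$-connected graph of order $n$ with minimum degree $\delta$, where $$n\ge \max\left\{(2b^2+3b+11)\delta-\left(2b^2+\tfrac52 b+\tfrac32\right)k+\tfrac32 b+2+\tfrac{3}{2b},\ \tfrac23 b^2\delta^3+\tfrac43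 b^2k\delta^2\right\}.$$ If $$\mu_1(G)\le \mu_1\bigl(K_\delta\vee(K_{n-(b+1)\delta+bk-1}\cup(b\delta-bk+1)K_1)\bigr),$$ then $G$ is $k$-critical with respect to $[1,b]$-odd factors, unless $$G\cong K_\delta\vee(K_{n-(b+1)\delta+bk-1}\cup(b\delta-bk+1)K_1).$$ -/

import Mathlib

/-- The distance matrix `D(G)`: its `(u, v)` entry is the graph distance between `u` and `v`. -/
noncomputable def distMatrix {V : Type*} (G : SimpleGraph V) : Matrix V V ℝ :=
  Matrix.of fun u v => (G.dist u v : ℝ)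

theorem distMatrix_isHermitian {V : Type*} (G : SimpleGraph V) : (distMatrix G).IsHermitian := by
  ext u v
  simp [distMatrix, SimpleGraph.dist_comm]

/-- The distance spectral radius `μ₁(G)`: the largest eigenvalue of the distance matrix.
(The supremum runs over the finite family of all eigenvalues, so it is a maximum as soon as `V`
is nonempty.) -/
noncomputable def distSpectralRadius {V : Type*} [Fintype V] [DecidableEq V]
    (G : SimpleGraph V) : ℝ :=
  ⨆ i : V, (distMatrix_isHermitian G).eigenvalues i

/-- The join `G ∨ H`: the disjoint union of `G` and `H` together with all edges between
the two vertex sets. -/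
def graphJoin {V W : Type*} (G : SimpleGraph V) (H : SimpleGraph W) : SimpleGraph (V ⊕ W) :=
  SimpleGraph.sum G H ⊔ completeBipartiteGraph V W

/-- The graph `K_s ∨ (K_m ∪ t K₁)`. -/
def joinGraph (s m t : ℕ) : SimpleGraph (Fin s ⊕ (Fin m ⊕ Fin t)) :=
  graphJoin (⊤ : SimpleGraph (Fin s))
    (SimpleGraph.sum (⊤ : SimpleGraph (Fin m)) (⊥ : SimpleGraph (Fin t)))

/-- `G` is `k`-connected: `G` has more than `k` vertices and deleting fewer than `k` vertices
always leaves a connected graph. -/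
def IsKConnected {V : Type*} [Fintype V] (G : SimpleGraph V) (k : ℕ) : Prop :=
  k < Fintype.card V ∧
    ∀ X : Finset V, X.card < k → (G.induce {v : V | v ∉ X}).Connected

/-- `G` contains a `[1,b]`-odd factor (`b` odd): a spanning subgraph `H` all of whose degrees lie
in `{1, 3, …, b}`. The degree of `v` in `H` is the number of its neighbours. -/
def HasOddFactor {V : Type*} [Finite V] (G : SimpleGraph V) (b : ℕ) : Prop :=
  ∃ H : SimpleGraph V, H ≤ G ∧
    ∀ v : V, Odd (H.neighborSet v).ncard ∧ (H.neighborSet v).ncard ≤ b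

/-- `G`, of order at least `k + 2`, is `k`-critical with respect to `[1,b]`-odd factors: deleting
any `k` vertices leaves a graph that contains a `[1,b]`-odd factor. -/
def IsKCriticalOddFactor {V : Type*} [Fintype V] (G : SimpleGraph V) (k b : ℕ) : Prop :=
  k + 2 ≤ Fintype.card V ∧
    ∀ X : Finset V, X.card = k → HasOddFactor (G.induce {v : V | v ∉ X}) b

/-- The extremal graph `K_δ ∨ (K_{n-(b+1)δ+bk-1} ∪ (bδ-bk+1) K₁)`. Both subtractions are exact
whenever `k ≤ δ` and `(b + 1) δ + 1 ≤ n + b k`. -/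
def extremalGraph (n b k δ : ℕ) :
    SimpleGraph (Fin δ ⊕ (Fin (n + b * k - (b + 1) * δ - 1) ⊕ Fin (b * δ - b * k + 1))) :=
  joinGraph δ (n + b * k - (b + 1) * δ - 1) (b * δ - b * k + 1)

/-! Suppose `G` is not critical and write `δ = k + d`, `t = b d + 1`; the extremal graph is `K_δ ∨
(K_m ∪ t K₁)`. Its Perron vector takes values `A < B` and `C ≤ 2A` on the three blocks. Place these
values on `V(G)` in any way with the right multiplicities and use the result as a Rayleigh test
vector. In a connected graph, distinct vertices are at distance at least 1, and at least 2 if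
nonadjacent; in the extremal graph these bounds are exact. So `μ₁(G) ≤ μ₁(extremal)` forces the
nonadjacent pairs of `G` to weigh at most as much as those of the extremal graph, for every
placement (`nonadjWeight_blockWeight_le`).

On the other side, Tutte's theorem for a clique blow-up of `G - X` yields a set `S` of `k + r`
vertices whose removal leaves at least `b r + 2` components
(`exists_separator_of_not_isKCriticalOddFactor`). Pairs in different components are nonadjacent, and
a placement adapted to `S` makes them too heavy. If `r < d`, the minimum degree makes every
component large, and splitting off the largest one from the rest suffices
(`false_of_small_separator`). If `r ≥ d`, the cross pairs weigh least when all components but one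
are singletons. This contradicts the bound unless `r = d` and every estimate is tight, which makes
`G` the extremal graph (`nonempty_iso_of_large_separator`). -/

/-! ### Rayleigh bound and the Perron vector of the extremal graph. -/

open Matrix in
theorem Matrix.IsHermitian.posSemidef_iSup_eigenvalues_sub {V : Type*} [Fintype V] [DecidableEq V]
    {M : Matrix V V ℝ} (hM : M.IsHermitian) :
    (algebraMap ℝ (Matrix V V ℝ) (⨆ i, hM.eigenvalues i) - M).PosSemidef := by
  have hH : (algebraMap ℝ (Matrix V V ℝ) (⨆ i, hM.eigenvalues i) - M).IsHermitian := by
    refine IsHermitian.sub ?_ hM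
    rw [Algebra.algebraMap_eq_smul_one, IsHermitian, conjTranspose_smul, conjTranspose_one]
    simp
  rw [hH.posSemidef_iff_eigenvalues_nonneg]
  intro i
  have h := hH.eigenvalues_mem_spectrum_real i
  rw [← spectrum.singleton_sub_eq, hM.spectrum_real_eq_range_eigenvalues] at h
  obtain ⟨a, ha, c, ⟨j, rfl⟩, hc⟩ := Set.mem_sub.1 h
  have h1 : a = ⨆ i, hM.eigenvalues i := ha
  have h2 : hM.eigenvalues j ≤ ⨆ i, hM.eigenvalues i :=
    le_ciSup (Set.finite_range _).bddAbove j
  simp only [Pi.zero_apply]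
  linarith

open Matrix in
theorem dotProduct_mulVec_distMatrix_le {V : Type*} [Fintype V] [DecidableEq V]
    (G : SimpleGraph V) (x : V → ℝ) :
    x ⬝ᵥ (distMatrix G *ᵥ x) ≤ distSpectralRadius G * (x ⬝ᵥ x) := by
  have h := (distMatrix_isHermitian G).posSemidef_iSup_eigenvalues_sub.dotProduct_mulVec_nonneg x
  rw [Algebra.algebraMap_eq_smul_one, sub_mulVec, smul_mulVec, one_mulVec, dotProduct_sub,
    dotProduct_smul] at h
  simp only [star_trivial, smul_eq_mul] at h
  exact sub_nonneg.1 h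

open Matrix in
/-- The distance matrix has a nonzero nonnegative eigenvector for its largest eigenvalue. -/
theorem exists_nonneg_distMatrix_eigenvector {V : Type*} [Fintype V] [DecidableEq V] [Nonempty V]
    (G : SimpleGraph V) :
    ∃ x : V → ℝ, (∀ v, 0 ≤ x v) ∧ x ≠ 0 ∧ distMatrix G *ᵥ x = distSpectralRadius G • x := by
  have hM := distMatrix_isHermitian G
  obtain ⟨i, hi⟩ := exists_eq_ciSup_of_finite (f := hM.eigenvalues)
  have hz : distMatrix G *ᵥ ⇑(hM.eigenvectorBasis i) =
      distSpectralRadius G • ⇑(hM.eigenvectorBasis i) := by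
    rw [hM.mulVec_eigenvectorBasis, hi, distSpectralRadius]
  have hz0 : hM.eigenvectorBasis i ≠ 0 := hM.eigenvectorBasis.orthonormal.ne_zero i
  obtain ⟨v, hv⟩ : ∃ v, hM.eigenvectorBasis i v ≠ 0 := by
    by_contra! h
    exact hz0 (PiLp.ext h)
  generalize (⇑(hM.eigenvectorBasis i) : V → ℝ) = z at hz hv
  refine ⟨fun v => |z v|, fun v => abs_nonneg _, fun h => hv (abs_eq_zero.1 (congrFun h v)), ?_⟩
  -- The entries of `D(G)` are nonnegative, so passing to absolute values keeps the norm and does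
  -- not lower the quadratic form. Hence `|z|` is also a maximiser, and a null vector of the
  -- positive semidefinite form `μ₁ I - D(G)` lies in its kernel.
  have hle : z ⬝ᵥ (distMatrix G *ᵥ z) ≤
      (fun v => |z v|) ⬝ᵥ (distMatrix G *ᵥ (fun v => |z v|)) := by
    simp only [dotProduct, mulVec, Finset.mul_sum]
    refine Finset.sum_le_sum fun u _ => Finset.sum_le_sum fun v _ => ?_
    calc z u * (distMatrix G u v * z v) ≤ |z u * (distMatrix G u v * z v)| := le_abs_self _
      _ = _ := by
        rw [abs_mul, abs_mul, abs_of_nonneg (a := distMatrix G u v) (by simp [distMatrix])]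
  have hsq : (fun v => |z v|) ⬝ᵥ (fun v => |z v|) = z ⬝ᵥ z := by
    simp [dotProduct, abs_mul_abs_self]
  have hP := hM.posSemidef_iSup_eigenvalues_sub
  have h0 := (hP.dotProduct_mulVec_zero_iff (fun v => |z v|)).1 (by
    refine le_antisymm ?_ (hP.dotProduct_mulVec_nonneg _)
    rw [hz, dotProduct_smul, smul_eq_mul] at hle
    rw [Algebra.algebraMap_eq_smul_one, sub_mulVec, smul_mulVec, one_mulVec, dotProduct_sub,
      dotProduct_smul]
    simp only [star_trivial, smul_eq_mul]
    rw [hsq]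
    rw [distSpectralRadius] at hle
    linarith)
  rw [Algebra.algebraMap_eq_smul_one, sub_mulVec, smul_mulVec, one_mulVec, sub_eq_zero] at h0
  exact h0.symm

theorem joinGraph_dist_eq_two {s m t : ℕ} (hs : 0 < s) {u v : Fin s ⊕ (Fin m ⊕ Fin t)}
    (huv : u ≠ v) (h : ¬ (joinGraph s m t).Adj u v) : (joinGraph s m t).dist u v = 2 := by
  have key : ∀ w : Fin m ⊕ Fin t, (joinGraph s m t).Adj (Sum.inl ⟨0, hs⟩) (Sum.inr w) := by
    intro w
    simp [joinGraph, graphJoin]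
  have h0 : ∀ u v, (joinGraph s m t).Adj (Sum.inl u) v ∨ Sum.inl u = v := by
    rintro u (v | v)
    · by_cases h : u = v
      · simp [h]
      · left; simp [joinGraph, graphJoin, h]
    · simp [joinGraph, graphJoin]
  rcases u with u | u
  · exact ((h0 u v).elim h huv).elim
  rcases v with v | v
  · exact ((h0 v (Sum.inr u)).elim (fun h' => h h'.symm) huv.symm).elim
  let p : (joinGraph s m t).Walk (Sum.inr u) (Sum.inr v) :=
    .cons (key u).symm (.cons (key v) .nil)
  have h1 : (joinGraph s m t).dist (Sum.inr u) (Sum.inr v) ≤ 2 := SimpleGraph.dist_le p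
  have h2 := (p.reachable.pos_dist_of_ne huv)
  have h3 : (joinGraph s m t).dist (Sum.inr u) (Sum.inr v) ≠ 1 := by
    rwa [Ne, SimpleGraph.dist_eq_one_iff_adj]
  omega

/-- The quotient eigenvalue equations for the distance spectral radius of `K_s ∨ (K_m ∪ t K₁)`,
with a positive solution. -/
theorem exists_joinGraph_eigenvalue_equations {s m t : ℕ} (hs : 0 < s) :
    ∃ A B C : ℝ, 0 < A ∧ A ≤ B ∧ 0 < C ∧ C ≤ 2 * A ∧
      (distSpectralRadius (joinGraph s m t) + 1) * A = s * A + m * B + t * C ∧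
      (distSpectralRadius (joinGraph s m t) + 1) * B = s * A + m * B + t * C + t * C ∧
      (distSpectralRadius (joinGraph s m t) + 2) * C =
        s * A + m * B + t * C + m * B + t * C := by
  classical
  have : Nonempty (Fin s) := ⟨⟨0, hs⟩⟩
  obtain ⟨x, hx0, hxne, hx⟩ := exists_nonneg_distMatrix_eigenvector (joinGraph s m t)
  set μ := distSpectralRadius (joinGraph s m t) with hμ
  have hent : ∀ u v, distMatrix (joinGraph s m t) u v =
      if u = v then 0 else if (joinGraph s m t).Adj u v then 1 else 2 := by
    intro u v
    simp only [distMatrix, Matrix.of_apply]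
    split_ifs with h1 h2
    · simp [h1]
    · exact_mod_cast SimpleGraph.dist_eq_one_iff_adj.2 h2
    · exact_mod_cast joinGraph_dist_eq_two hs h1 h2
  have hrow : ∀ u, ∑ v, (if u = v then 0 else if (joinGraph s m t).Adj u v then 1 else 2) * x v
      = μ * x u := by
    intro u
    have := congrFun hx u
    simpa [Matrix.mulVec, dotProduct, hent] using this
  obtain ⟨X₁, h₁⟩ : ∃ X, X = ∑ a, x (Sum.inl a) := ⟨_, rfl⟩
  obtain ⟨X₂, h₂⟩ : ∃ X, X = ∑ a, x (Sum.inr (Sum.inl a)) := ⟨_, rfl⟩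
  obtain ⟨X₃, h₃⟩ : ∃ X, X = ∑ a, x (Sum.inr (Sum.inr a)) := ⟨_, rfl⟩
  have hdel : ∀ {k : ℕ} (a : Fin k) (f : Fin k → ℝ),
      ∑ b, (if a = b then 0 else f b) = ∑ b, f b - f a := by
    intro k a f
    have : ∀ b, (if a = b then 0 else f b) = f b - if a = b then f b else 0 := by
      intro b; split_ifs <;> ring
    simp only [this, Finset.sum_sub_distrib, Finset.sum_ite_eq, Finset.mem_univ, if_true]
  have hif : ∀ (p : Prop) [Decidable p] (a b c : ℝ),
      (if p then a else if p then b else c) = if p then a else c := by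
    intro p _ a b c; split_ifs <;> rfl
  have e₁ : ∀ a, μ * x (Sum.inl a) = X₁ - x (Sum.inl a) + X₂ + X₃ := by
    intro a
    rw [← hrow, h₁, h₂, h₃]
    simp only [Fintype.sum_sum_type, joinGraph, graphJoin]
    simp [hif, hdel]
    ring
  have e₂ : ∀ a, μ * x (Sum.inr (Sum.inl a)) = X₁ + (X₂ - x (Sum.inr (Sum.inl a))) + 2 * X₃ := by
    intro a
    rw [← hrow, h₁, h₂, h₃]
    simp only [Fintype.sum_sum_type, joinGraph, graphJoin]
    simp [hif, hdel, ← Finset.mul_sum]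
    ring
  have e₃ : ∀ a, μ * x (Sum.inr (Sum.inr a)) =
      X₁ + 2 * X₂ + 2 * (X₃ - x (Sum.inr (Sum.inr a))) := by
    intro a
    rw [← hrow, h₁, h₂, h₃]
    simp only [Fintype.sum_sum_type, joinGraph, graphJoin]
    simp [hdel, ← Finset.mul_sum]
    ring
  have p₁ : 0 ≤ X₁ := h₁ ▸ Finset.sum_nonneg fun _ _ => hx0 _
  have p₂ : 0 ≤ X₂ := h₂ ▸ Finset.sum_nonneg fun _ _ => hx0 _
  have p₃ : 0 ≤ X₃ := h₃ ▸ Finset.sum_nonneg fun _ _ => hx0 _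
  have hS : 0 < X₁ + X₂ + X₃ := by
    have : X₁ + X₂ + X₃ = ∑ v, x v := by
      rw [h₁, h₂, h₃, Fintype.sum_sum_type, Fintype.sum_sum_type, add_assoc]
    rw [this]
    refine (Finset.sum_nonneg fun v _ => hx0 v).lt_of_ne' fun h => hxne (funext fun v => ?_)
    exact (Finset.sum_eq_zero_iff_of_nonneg fun v _ => hx0 v).1 h v (Finset.mem_univ v)
  -- On the `K_s` block the eigenvalue equation reads `(μ + 1) x = X₁ + X₂ + X₃ > 0` with `x ≥ 0`.
  have hμ1 : 0 < μ + 1 := by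
    have h := e₁ ⟨0, hs⟩
    have h' := hx0 (Sum.inl ⟨0, hs⟩)
    by_contra! hneg
    nlinarith
  have hμ2 : 0 < μ + 2 := by linarith
  have q₁ : X₁ = s * ((X₁ + X₂ + X₃) / (μ + 1)) := by
    have : ∀ a, x (Sum.inl a) = (X₁ + X₂ + X₃) / (μ + 1) := fun a => by
      rw [eq_div_iff hμ1.ne']; linarith [e₁ a]
    conv_lhs => rw [h₁]
    simp only [this, Finset.sum_const, Finset.card_univ, Fintype.card_fin, nsmul_eq_mul]
  have q₂ : X₂ = m * ((X₁ + X₂ + X₃ + X₃) / (μ + 1)) := by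
    have : ∀ a, x (Sum.inr (Sum.inl a)) = (X₁ + X₂ + X₃ + X₃) / (μ + 1) := fun a => by
      rw [eq_div_iff hμ1.ne']; linarith [e₂ a]
    conv_lhs => rw [h₂]
    simp only [this, Finset.sum_const, Finset.card_univ, Fintype.card_fin, nsmul_eq_mul]
  have q₃ : X₃ = t * ((X₁ + X₂ + X₃ + X₂ + X₃) / (μ + 2)) := by
    have : ∀ a, x (Sum.inr (Sum.inr a)) = (X₁ + X₂ + X₃ + X₂ + X₃) / (μ + 2) := fun a => by
      rw [eq_div_iff hμ2.ne']; linarith [e₃ a]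
    conv_lhs => rw [h₃]
    simp only [this, Finset.sum_const, Finset.card_univ, Fintype.card_fin, nsmul_eq_mul]
  -- The eigenvalue equations express each entry through block sums, so the vector is constant on
  -- blocks. Defining the values by these quotients keeps them positive even for an empty block.
  refine ⟨(X₁ + X₂ + X₃) / (μ + 1), (X₁ + X₂ + X₃ + X₃) / (μ + 1),
    (X₁ + X₂ + X₃ + X₂ + X₃) / (μ + 2), by positivity,
    (div_le_div_iff_of_pos_right hμ1).2 (by linarith), by positivity,
    ?_, ?_, ?_, ?_⟩
  · rw [← mul_div_assoc]
    exact div_le_div₀ (by linarith) (by linarith) hμ1 (by linarith)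
  all_goals
    rw [← q₁, ← q₂, ← q₃]
    field_simp

/-! ### From Tutte's theorem to many components. -/

/-- The blow-up of `G` in which every vertex becomes a clique on `b` vertices. -/
def SimpleGraph.cliqueBlowup {V : Type*} (G : SimpleGraph V) (b : ℕ) :
    SimpleGraph (V × Fin b) where
  Adj p q := p ≠ q ∧ (p.1 = q.1 ∨ G.Adj p.1 q.1)
  symm := ⟨fun _ _ h => ⟨h.1.symm, h.2.imp Eq.symm fun h => h.symm⟩⟩
  loopless := ⟨fun _ h => h.1 rfl⟩

/-- A perfect matching of the clique blow-up of odd size `b` projects, counting multiplicities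
modulo two, to a `[1,b]`-odd factor. -/
theorem hasOddFactor_of_isPerfectMatching_cliqueBlowup {V : Type*} [Fintype V] {G : SimpleGraph V}
    {b : ℕ} (hb : Odd b) {M : (G.cliqueBlowup b).Subgraph} (hM : M.IsPerfectMatching) :
    HasOddFactor G b := by
  classical
  choose f hf hfu using SimpleGraph.Subgraph.isPerfectMatching_iff.1 hM
  have hff : ∀ p, f (f p) = p := fun p => (hfu (f p) p (hf p).symm).symm
  have hfne : ∀ p, f p ≠ p := fun p => (M.adj_sub (hf p)).1.symm
  have hadj : ∀ p, p.1 = (f p).1 ∨ G.Adj p.1 (f p).1 := fun p => (M.adj_sub (hf p)).2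
  -- For `u ≠ v` this counts the matching edges between the two fibres. For `u = v` it counts
  -- matched vertices, hence every inner edge twice, which is why it is even.
  let c : V → V → ℕ := fun u v => (Finset.univ.filter fun i : Fin b => (f (u, i)).1 = v).card
  have hsymm : ∀ u v, c u v = c v u := by
    intro u v
    have key : ∀ u v (i : Fin b), (f (u, i)).1 = v → f (v, (f (u, i)).2) = (u, i) := by
      rintro u v i rfl
      exact hff _
    refine Finset.card_nbij' (fun i => (f (u, i)).2) (fun i => (f (v, i)).2) ?_ ?_ ?_ ?_
    · intro i hi
      simp only [Finset.coe_filter, Finset.mem_univ, true_and, Set.mem_ofPred_eq] at hi ⊢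
      rw [key u v i hi]
    · intro i hi
      simp only [Finset.coe_filter, Finset.mem_univ, true_and, Set.mem_ofPred_eq] at hi ⊢
      rw [key v u i hi]
    · intro i hi
      simp only [Finset.coe_filter, Finset.mem_univ, true_and, Set.mem_ofPred_eq] at hi ⊢
      rw [key u v i hi]
    · intro i hi
      simp only [Finset.coe_filter, Finset.mem_univ, true_and, Set.mem_ofPred_eq] at hi ⊢
      rw [key v u i hi]
  have heven : ∀ u, Even (c u u) := by
    intro u
    rw [← ZMod.natCast_eq_zero_iff_even]
    have hpair : ∀ i : Fin b, (f (u, i)).1 = u → f (u, i) = (u, (f (u, i)).2) :=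
      fun i hi => Prod.ext hi rfl
    have : ∑ i ∈ Finset.univ.filter (fun i : Fin b => (f (u, i)).1 = u), (1 : ZMod 2) = 0 := by
      refine Finset.sum_involution (fun i _ => (f (u, i)).2) ?_ ?_ ?_ ?_
      · intro i _; decide
      · intro i hi _ h
        refine hfne (u, i) ?_
        rw [hpair i (Finset.mem_filter.1 hi).2, h]
      · intro i hi
        have h := hpair i (Finset.mem_filter.1 hi).2
        simp only [Finset.mem_filter, Finset.mem_univ, true_and]
        rw [← h, hff]
      · intro i hi
        have h := hpair i (Finset.mem_filter.1 hi).2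
        rw [← h, hff]
    simpa [c] using this
  have hsum : ∀ u, ∑ v, c u v = b := by
    intro u
    have := Finset.card_eq_sum_card_fiberwise (s := (Finset.univ : Finset (Fin b)))
      (t := (Finset.univ : Finset V)) (f := fun i => (f (u, i)).1) (by intro x _; simp)
    simpa [c] using this.symm
  -- Keep the edges of odd multiplicity. Modulo 2 the degree of `u` is `b - c u u`, which is odd;
  -- and each kept edge uses at least one of the `b` copies of `u`.
  refine ⟨⟨fun u v => u ≠ v ∧ Odd (c u v), ⟨fun u v h => ⟨h.1.symm, hsymm u v ▸ h.2⟩⟩,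
    ⟨fun _ h => h.1 rfl⟩⟩, ?_, ?_⟩
  · rintro u v ⟨hne, hodd⟩
    obtain ⟨i, hi⟩ := Finset.card_pos.1 hodd.pos
    have hi' := (Finset.mem_filter.1 hi).2
    have := hadj (u, i)
    rw [hi'] at this
    exact this.resolve_left hne
  · intro u
    have hset : SimpleGraph.neighborSet ⟨fun u v => u ≠ v ∧ Odd (c u v),
        ⟨fun u v h => ⟨h.1.symm, hsymm u v ▸ h.2⟩⟩, ⟨fun _ h => h.1 rfl⟩⟩ u =
        ((Finset.univ.erase u).filter fun v => Odd (c u v) : Finset V) := by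
      ext v
      simp [SimpleGraph.mem_neighborSet, ne_comm]
    rw [hset, Set.ncard_coe_finset]
    have htot : ∑ v ∈ Finset.univ.erase u, c u v + c u u = b := by
      rw [Finset.sum_erase_add _ _ (Finset.mem_univ u), hsum]
    constructor
    · rw [← Finset.odd_sum_iff_odd_card_odd]
      have h := heven u
      rw [← htot, Nat.odd_add] at hb
      exact hb.2 h
    · calc _ = ∑ v ∈ (Finset.univ.erase u).filter fun v => Odd (c u v), 1 := by simp
        _ ≤ ∑ v ∈ (Finset.univ.erase u).filter fun v => Odd (c u v), c u v :=
          Finset.sum_le_sum fun v hv => (Finset.mem_filter.1 hv).2.pos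
        _ ≤ ∑ v ∈ Finset.univ.erase u, c u v :=
          Finset.sum_le_sum_of_subset (Finset.filter_subset _ _)
        _ ≤ b := by omega

/-- If a graph of even order has no `[1,b]`-odd factor, `b` odd, then deleting a suitable vertex
set `S` leaves at least `b |S| + 2` components. -/
theorem exists_many_components_of_not_hasOddFactor {V : Type*} [Fintype V] {G : SimpleGraph V}
    {b : ℕ} (hb : Odd b) (hV : Even (Fintype.card V)) (hG : ¬ HasOddFactor G b) :
    ∃ (S : Finset V) (f : V → Fin (b * S.card + 2)),
      (∀ u v, u ∉ S → v ∉ S → G.Adj u v → f u = f v) ∧ ∀ l, ∃ v ∉ S, f v = l := by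
  classical
  obtain ⟨U, hU⟩ : ∃ U, (G.cliqueBlowup b).IsTutteViolator U := by
    by_contra! h
    obtain ⟨M, hM⟩ := SimpleGraph.tutte.2 h
    exact hG (hasOddFactor_of_isPerfectMatching_cliqueBlowup hb hM)
  rw [SimpleGraph.IsTutteViolator] at hU
  set G' := ((⊤ : (G.cliqueBlowup b).Subgraph).deleteVerts U).coe with hG'
  have hverts : ((⊤ : (G.cliqueBlowup b).Subgraph).deleteVerts U).verts = Uᶜ := by
    ext; simp
  have hpar := SimpleGraph.odd_ncard_oddComponents G'
  have hcardV : Nat.card ((⊤ : (G.cliqueBlowup b).Subgraph).deleteVerts U).verts + U.ncard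
      = Fintype.card V * b := by
    rw [hverts, Nat.card_coe_set_eq, add_comm, Set.ncard_add_ncard_compl]
    simp
  have hparU : Even
      (Nat.card ((⊤ : (G.cliqueBlowup b).Subgraph).deleteVerts U).verts + U.ncard) := by
    rw [hcardV]; exact hV.mul_right b
  -- The blow-up has even order, so `|U|` and the number of odd components have the same parity and
  -- the excess of one improves to two.
  have htwo : U.ncard + 2 ≤ G'.oddComponents.ncard := by
    rw [Nat.even_add'] at hparU
    have : Odd (G'.oddComponents.ncard) ↔ Odd U.ncard := hpar.trans hparU
    simp only [Nat.odd_iff] at this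
    omega
  have hcomp : U.ncard + 2 ≤ Nat.card G'.ConnectedComponent :=
    htwo.trans (by rw [← Set.ncard_univ]; exact Set.ncard_le_ncard (Set.subset_univ _))
  -- Only vertices whose whole fibre lies in `U` are deleted. Every other vertex keeps a copy, and
  -- its remaining copies all lie in one component.
  let S : Finset V := Finset.univ.filter fun v => ∀ i, (v, i) ∈ U
  have hS : b * S.card ≤ U.ncard := by
    have : (S ×ˢ (Finset.univ : Finset (Fin b)) : Finset _).card ≤ U.ncard := by
      rw [← Set.ncard_coe_finset]
      refine Set.ncard_le_ncard ?_
      rintro ⟨v, i⟩ h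
      simp only [Finset.coe_product, Set.mem_prod] at h
      exact (Finset.mem_filter.1 (Finset.mem_coe.1 h.1)).2 i
    simpa [mul_comm] using this
  have hrep : ∀ v, v ∉ S → ∃ i, (v, i) ∉ U := by
    intro v hv
    by_contra! h
    exact hv (Finset.mem_filter.2 ⟨Finset.mem_univ v, h⟩)
  have hmem : ∀ p, p ∉ U → p ∈ ((⊤ : (G.cliqueBlowup b).Subgraph).deleteVerts U).verts := by
    intro p hp; rw [hverts]; exact hp
  have hfin : Finite G'.ConnectedComponent := inferInstance
  have := Fintype.ofFinite G'.ConnectedComponent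
  obtain ⟨g⟩ : Nonempty (Fin (b * S.card + 2) ↪ G'.ConnectedComponent) := by
    rw [Function.Embedding.nonempty_iff_card_le]
    rw [Fintype.card_fin, ← Nat.card_eq_fintype_card]
    omega
  -- A left inverse of `g` merges the surplus components into existing labels.
  let r : G'.ConnectedComponent → Fin (b * S.card + 2) := Function.invFun g
  have hr : ∀ l, r (g l) = l := Function.leftInverse_invFun g.injective
  have hadj : ∀ p q (hp : p ∉ U) (hq : q ∉ U), (p.1 = q.1 ∨ G.Adj p.1 q.1) →
      G'.connectedComponentMk ⟨p, hmem p hp⟩ = G'.connectedComponentMk ⟨q, hmem q hq⟩ := by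
    intro p q hp hq h
    by_cases hpq : p = q
    · subst hpq; rfl
    · refine SimpleGraph.ConnectedComponent.sound (SimpleGraph.Adj.reachable ?_)
      simp only [hG', SimpleGraph.Subgraph.coe_adj, SimpleGraph.Subgraph.deleteVerts_adj]
      exact ⟨trivial, hp, trivial, hq, hpq, h⟩
  refine ⟨S, fun v => if hv : v ∈ S then 0 else
    r (G'.connectedComponentMk ⟨(v, (hrep v hv).choose), hmem _ (hrep v hv).choose_spec⟩), ?_, ?_⟩
  · intro u v hu hv huv
    simp only [hu, hv, dif_neg, not_false_eq_true]
    rw [hadj _ _ (hrep u hu).choose_spec (hrep v hv).choose_spec (Or.inr huv)]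
  · intro l
    obtain ⟨⟨p, hp⟩, hl⟩ := (g l).exists_rep
    have hpU : p ∉ U := by rw [hverts] at hp; exact hp
    have hpS : p.1 ∉ S := fun h => hpU ((Finset.mem_filter.1 h).2 p.2)
    refine ⟨p.1, hpS, ?_⟩
    simp only [hpS, dif_neg, not_false_eq_true]
    rw [hadj _ p (hrep p.1 hpS).choose_spec hpU (Or.inl rfl)]
    rw [show G'.connectedComponentMk ⟨p, hmem p hpU⟩ = g l from hl, hr]

/-! ### Block weights and the weight of nonadjacent pairs. -/

/-- The vector with value `a` on `Z₁`, `c` on `Z₃ \ Z₁` and `b` elsewhere. -/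
noncomputable def blockWeight {V : Type*} [DecidableEq V] (Z₁ Z₃ : Finset V) (a b c : ℝ) (v : V) :
    ℝ :=
  if v ∈ Z₁ then a else if v ∈ Z₃ then c else b

theorem sum_blockWeight {V : Type*} [DecidableEq V] {Z₁ Z₃ : Finset V} (hZ : Disjoint Z₁ Z₃)
    (a b c : ℝ) {Y : Finset V} {i j k : ℕ} (hi : (Y ∩ Z₁).card = i) (hj : (Y ∩ Z₃).card = j)
    (hY : Y.card = i + j + k) :
    ∑ v ∈ Y, blockWeight Z₁ Z₃ a b c v = i * a + j * c + k * b := by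
  have h : ∀ v, blockWeight Z₁ Z₃ a b c v =
      (if v ∈ Z₁ then a - b else 0) + (if v ∈ Z₃ then c - b else 0) + b := by
    intro v
    have : v ∈ Z₁ → v ∉ Z₃ := fun h => Finset.disjoint_left.1 hZ h
    unfold blockWeight
    split_ifs <;> first | exact absurd ‹v ∈ Z₃› (this ‹v ∈ Z₁›) | ring
  simp only [h, Finset.sum_add_distrib, Finset.sum_ite_mem, Finset.sum_const, hi, hj, hY,
    nsmul_eq_mul]
  push_cast
  ring

theorem blockWeight_sq {V : Type*} [DecidableEq V] (Z₁ Z₃ : Finset V) (a b c : ℝ) (v : V) :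
    blockWeight Z₁ Z₃ a b c v ^ 2 = blockWeight Z₁ Z₃ (a ^ 2) (b ^ 2) (c ^ 2) v := by
  unfold blockWeight
  split_ifs <;> rfl

open Classical in
/-- The weight of the ordered nonadjacent pairs of distinct vertices. -/
noncomputable def nonadjWeight {V : Type*} [Fintype V] (G : SimpleGraph V) (x : V → ℝ) : ℝ :=
  ∑ p : V × V, if p.1 ≠ p.2 ∧ ¬ G.Adj p.1 p.2 then x p.1 * x p.2 else 0

/-- The left side is the quadratic form obtained from `D(G)` by replacing every distance above 2 by
2; connectedness rules out the junk distance 0 between distinct vertices. -/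
theorem sum_sq_add_nonadjWeight_le {V : Type*} [Fintype V] [DecidableEq V] {G : SimpleGraph V}
    (hG : G.Connected) {x : V → ℝ} (hx : ∀ v, 0 ≤ x v) :
    (∑ v, x v) ^ 2 - ∑ v, x v ^ 2 + nonadjWeight G x ≤ distSpectralRadius G * ∑ v, x v ^ 2 := by
  classical
  have h := dotProduct_mulVec_distMatrix_le G x
  have hsq : x ⬝ᵥ x = ∑ v, x v ^ 2 := by simp [dotProduct, sq]
  rw [hsq] at h
  refine le_trans ?_ h
  have h1 : (∑ v, x v) ^ 2 - ∑ v, x v ^ 2 =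
      ∑ p : V × V, if p.1 ≠ p.2 then x p.1 * x p.2 else 0 := by
    rw [Fintype.sum_prod_type, sq, Finset.sum_mul_sum, ← Finset.sum_sub_distrib]
    refine Finset.sum_congr rfl fun u _ => ?_
    have : ∀ v, (if u ≠ v then x u * x v else 0) = x u * x v - if u = v then x u * x v else 0 := by
      intro v; by_cases h : u = v <;> simp [h]
    simp [this, sq]
  have h2 : x ⬝ᵥ (distMatrix G).mulVec x = ∑ p : V × V, G.dist p.1 p.2 * (x p.1 * x p.2) := by
    rw [Fintype.sum_prod_type]
    simp only [dotProduct, Matrix.mulVec, Finset.mul_sum, distMatrix, Matrix.of_apply]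
    exact Finset.sum_congr rfl fun u _ => Finset.sum_congr rfl fun v _ => by ring
  rw [h1, h2, nonadjWeight, ← Finset.sum_add_distrib]
  refine Finset.sum_le_sum fun p _ => ?_
  have hp : 0 ≤ x p.1 * x p.2 := mul_nonneg (hx _) (hx _)
  by_cases h3 : p.1 = p.2
  · simp [h3]
  · have hpos : 0 < G.dist p.1 p.2 := hG.pos_dist_of_ne h3
    by_cases h4 : G.Adj p.1 p.2
    · simp [h3, h4, SimpleGraph.dist_eq_one_iff_adj.2 h4]
    · have : G.dist p.1 p.2 ≠ 1 := fun h => h4 (SimpleGraph.dist_eq_one_iff_adj.1 h)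
      have h5 : (2 : ℝ) ≤ G.dist p.1 p.2 := by exact_mod_cast (by omega : 2 ≤ G.dist p.1 p.2)
      simp only [ne_eq, h3, not_false_eq_true, if_true, h4, and_self]
      nlinarith

/-- Weighing the vertices by the Perron vector of `K_s ∨ (K_m ∪ t K₁)`, a connected graph of no
larger distance spectral radius has nonadjacent pairs of no larger weight. -/
theorem nonadjWeight_blockWeight_le {V : Type*} [Fintype V] [DecidableEq V] {G : SimpleGraph V}
    (hG : G.Connected) {s m t : ℕ} (hcard : Fintype.card V = s + t + m) {μ A B C : ℝ}
    (hA : 0 ≤ A) (hB : 0 ≤ B) (hC : 0 ≤ C)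
    (h₁ : (μ + 1) * A = s * A + m * B + t * C)
    (h₂ : (μ + 1) * B = s * A + m * B + t * C + t * C)
    (h₃ : (μ + 2) * C = s * A + m * B + t * C + m * B + t * C)
    (hμ : distSpectralRadius G ≤ μ) {Z₁ Z₃ : Finset V} (hZ : Disjoint Z₁ Z₃)
    (hZ₁ : Z₁.card = s) (hZ₃ : Z₃.card = t) :
    nonadjWeight G (blockWeight Z₁ Z₃ A B C) ≤ 2 * t * m * B * C + t * (t - 1) * C ^ 2 := by
  have hx : ∀ v, 0 ≤ blockWeight Z₁ Z₃ A B C v := by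
    intro v; unfold blockWeight; split_ifs <;> assumption
  have h := sum_sq_add_nonadjWeight_le hG hx
  have hi : (Finset.univ ∩ Z₁).card = s := by simpa using hZ₁
  have hj : (Finset.univ ∩ Z₃).card = t := by simpa using hZ₃
  have hY : (Finset.univ : Finset V).card = s + t + m := hcard
  simp only [blockWeight_sq] at h
  rw [sum_blockWeight hZ _ _ _ hi hj hY, sum_blockWeight hZ _ _ _ hi hj hY] at h
  have hle : distSpectralRadius G * (s * A ^ 2 + t * C ^ 2 + m * B ^ 2) ≤
      μ * (s * A ^ 2 + t * C ^ 2 + m * B ^ 2) :=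
    mul_le_mul_of_nonneg_right hμ (by positivity)
  -- This is the Rayleigh identity of the extremal graph, obtained by weighting its block equations
  -- with `s A`, `m B`, `t C`.
  have key : μ * (s * A ^ 2 + t * C ^ 2 + m * B ^ 2) = (s * A + t * C + m * B) ^ 2 -
      (s * A ^ 2 + t * C ^ 2 + m * B ^ 2) + (2 * t * m * B * C + t * (t - 1) * C ^ 2) := by
    linear_combination (s : ℝ) * A * h₁ + m * B * h₂ + t * C * h₃
  linarith

theorem sq_sub_sum_sq_eq {V ι : Type*} [Fintype V] [DecidableEq V] [Fintype ι] [DecidableEq ι]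
    (Y : Finset V) (f : V → ι) (x : V → ℝ) :
    (∑ v ∈ Y, x v) ^ 2 - ∑ l, (∑ v ∈ Y with f v = l, x v) ^ 2 =
      ∑ p : V × V, if p.1 ∈ Y ∧ p.2 ∈ Y ∧ f p.1 ≠ f p.2 then x p.1 * x p.2 else 0 := by
  have h1 : ∑ l, (∑ v ∈ Y with f v = l, x v) ^ 2 =
      ∑ u ∈ Y, ∑ v ∈ Y, if f u = f v then x u * x v else 0 := by
    have : ∀ l, (∑ v ∈ Y with f v = l, x v) ^ 2 =
        ∑ u ∈ Y, if f u = l then x u * ∑ v ∈ Y with f v = l, x v else 0 := by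
      intro l
      rw [sq, Finset.sum_mul, Finset.sum_filter]
    simp only [this]
    rw [Finset.sum_comm]
    refine Finset.sum_congr rfl fun u _ => ?_
    rw [Fintype.sum_ite_eq, Finset.mul_sum, Finset.sum_filter]
    exact Finset.sum_congr rfl fun v _ => by simp only [eq_comm]
  rw [h1, sq, Finset.sum_mul_sum, ← Finset.sum_sub_distrib, Fintype.sum_prod_type]
  have h2 : ∀ u, (∑ v, if u ∈ Y ∧ v ∈ Y ∧ f u ≠ f v then x u * x v else 0) =
      if u ∈ Y then ∑ v, if v ∈ Y then (if f u ≠ f v then x u * x v else 0) else 0 else 0 := by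
    intro u
    by_cases hu : u ∈ Y
    · simp only [hu, true_and, if_true]
      exact Finset.sum_congr rfl fun v _ => by by_cases hv : v ∈ Y <;> simp [hv]
    · simp [hu]
  simp only [h2, Finset.sum_ite_mem, Finset.univ_inter, ← Finset.sum_sub_distrib]
  refine Finset.sum_congr rfl fun u _ => Finset.sum_congr rfl fun v _ => ?_
  by_cases h : f u = f v <;> simp [h]

theorem sq_sub_sum_sq_le_nonadjWeight {V ι : Type*} [Fintype V] [DecidableEq V] [Fintype ι]
    [DecidableEq ι] {G : SimpleGraph V} {Y : Finset V} {f : V → ι} {x : V → ℝ}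
    (hx : ∀ v, 0 ≤ x v) (hf : ∀ u ∈ Y, ∀ v ∈ Y, G.Adj u v → f u = f v) :
    (∑ v ∈ Y, x v) ^ 2 - ∑ l, (∑ v ∈ Y with f v = l, x v) ^ 2 ≤ nonadjWeight G x := by
  classical
  rw [sq_sub_sum_sq_eq, nonadjWeight]
  refine Finset.sum_le_sum fun p _ => ?_
  have hp : 0 ≤ x p.1 * x p.2 := mul_nonneg (hx _) (hx _)
  split_ifs with h1 h2
  · exact le_rfl
  · exact absurd ⟨fun h => h1.2.2 (h ▸ rfl), fun h => h1.2.2 (hf _ h1.1 _ h1.2.1 h)⟩ h2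
  · exact hp
  · exact le_rfl

/-- Used in the equality case: one nonadjacent pair not already counted as a cross pair makes the
estimate strict. -/
theorem sq_sub_sum_sq_lt_nonadjWeight {V ι : Type*} [Fintype V] [DecidableEq V] [Fintype ι]
    [DecidableEq ι] {G : SimpleGraph V} {Y : Finset V} {f : V → ι} {x : V → ℝ}
    (hx : ∀ v, 0 < x v) (hf : ∀ u ∈ Y, ∀ v ∈ Y, G.Adj u v → f u = f v)
    {a b : V} (hab : a ≠ b) (hnadj : ¬ G.Adj a b) (hY : ¬ (a ∈ Y ∧ b ∈ Y ∧ f a ≠ f b)) :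
    (∑ v ∈ Y, x v) ^ 2 - ∑ l, (∑ v ∈ Y with f v = l, x v) ^ 2 < nonadjWeight G x := by
  classical
  rw [sq_sub_sum_sq_eq, nonadjWeight]
  refine Finset.sum_lt_sum (fun p _ => ?_) ⟨(a, b), Finset.mem_univ _, ?_⟩
  · have hp : 0 ≤ x p.1 * x p.2 := (mul_pos (hx _) (hx _)).le
    split_ifs with h1 h2
    · exact le_rfl
    · exact absurd ⟨fun h => h1.2.2 (h ▸ rfl), fun h => h1.2.2 (hf _ h1.1 _ h1.2.1 h)⟩ h2
    · exact hp
    · exact le_rfl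
  · rw [if_neg hY, if_pos ⟨hab, hnadj⟩]
    exact mul_pos (hx _) (hx _)

theorem nonempty_iso_joinGraph {V : Type*} [Fintype V] [DecidableEq V] {G : SimpleGraph V}
    {s m t : ℕ} {S P Z : Finset V} (hSP : Disjoint S P) (hSZ : Disjoint S Z) (hPZ : Disjoint P Z)
    (hS : S.card = s) (hP : P.card = m) (hZ : Z.card = t) (hcard : Fintype.card V = s + (m + t))
    (hadj : ∀ u v, G.Adj u v ↔ u ≠ v ∧ (u ∈ S ∨ v ∈ S ∨ (u ∈ P ∧ v ∈ P))) :
    Nonempty (G ≃g joinGraph s m t) := by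
  let e₁ := (S.equivFinOfCardEq hS).symm
  let e₂ := (P.equivFinOfCardEq hP).symm
  let e₃ := (Z.equivFinOfCardEq hZ).symm
  let φ : Fin s ⊕ (Fin m ⊕ Fin t) → V :=
    Sum.elim (fun i => (e₁ i : V)) (Sum.elim (fun i => (e₂ i : V)) (fun i => (e₃ i : V)))
  have hinj : Function.Injective φ := by
    have d₁ : ∀ i j, (e₁ i : V) ≠ e₂ j := fun i j => hSP.forall_ne_finset (e₁ i).2 (e₂ j).2
    have d₂ : ∀ i j, (e₁ i : V) ≠ e₃ j := fun i j => hSZ.forall_ne_finset (e₁ i).2 (e₃ j).2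
    have d₃ : ∀ i j, (e₂ i : V) ≠ e₃ j := fun i j => hPZ.forall_ne_finset (e₂ i).2 (e₃ j).2
    refine Function.Injective.sumElim (Subtype.val_injective.comp e₁.injective)
      (Function.Injective.sumElim (Subtype.val_injective.comp e₂.injective)
        (Subtype.val_injective.comp e₃.injective) d₃) ?_
    rintro i (j | j)
    · exact d₁ i j
    · exact d₂ i j
  have hbij : Function.Bijective φ :=
    (Fintype.bijective_iff_injective_and_card φ).2 ⟨hinj, by simp [hcard]⟩
  refine ⟨SimpleGraph.Iso.symm ⟨Equiv.ofBijective φ hbij, ?_⟩⟩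
  intro u v
  rw [Equiv.ofBijective_apply, Equiv.ofBijective_apply, hadj, hinj.ne_iff]
  have m₁ : ∀ i, (e₁ i : V) ∈ S := fun i => (e₁ i).2
  have m₂ : ∀ i, (e₂ i : V) ∈ P := fun i => (e₂ i).2
  have n₂ : ∀ i, (e₂ i : V) ∉ S := fun i => Finset.disjoint_right.1 hSP (e₂ i).2
  have n₃ : ∀ i, (e₃ i : V) ∉ S := fun i => Finset.disjoint_right.1 hSZ (e₃ i).2
  have n₄ : ∀ i, (e₃ i : V) ∉ P := fun i => Finset.disjoint_right.1 hPZ (e₃ i).2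
  rcases u with u | u | u <;> rcases v with v | v | v <;>
    simp [φ, m₁, m₂, n₂, n₃, n₄, joinGraph, graphJoin]

/-! ### Weight placements adapted to a separator. -/

/-- A small separator `S` whose removal leaves two large sides `P` and `R` is impossible when the
nonadjacent pairs weigh no more than in `K_δ ∨ (K_{p+h} ∪ t K₁)`. -/
theorem false_of_nonadjWeight_le_of_two_sides {V : Type*} [Fintype V] [DecidableEq V]
    {G : SimpleGraph V} {S P R : Finset V} (hSP : Disjoint S P) (hSR : Disjoint S R)
    (hPR : Disjoint P R) (hadj : ∀ u ∈ P, ∀ v ∈ R, ¬ G.Adj u v) {j h t : ℕ}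
    (hR : R.card = t + j + h) (hlt : 2 * t * h + 2 * t * t < P.card * (j + h) + 2 * t)
    {A B C : ℝ} (hA : 0 < A) (hAB : A ≤ B) (hC : 0 < C) (hCA : C ≤ 2 * A)
    (hQ : ∀ Z₁ Z₃ : Finset V, Disjoint Z₁ Z₃ → Z₁.card = S.card + j → Z₃.card = t →
      nonadjWeight G (blockWeight Z₁ Z₃ A B C) ≤
        2 * t * (P.card + h : ℕ) * B * C + t * (t - 1) * C ^ 2) : False := by
  -- `S` is too small for the `A` block, so `j` vertices of `R` complete it; `t` further vertices of
  -- `R` get `C`, and the last `h` get `B`.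
  obtain ⟨J, hJR, hJ⟩ := Finset.exists_subset_card_eq (s := R) (n := j) (by omega)
  have hRJ : (R \ J).card = t + h := by rw [Finset.card_sdiff_of_subset hJR]; omega
  obtain ⟨Z, hZR, hZ⟩ := Finset.exists_subset_card_eq (s := R \ J) (n := t) (by omega)
  have hSJ : Disjoint S J := hSR.mono_right hJR
  have hZR' : Z ⊆ R := hZR.trans Finset.sdiff_subset
  have hJZ : Disjoint J Z := (Finset.disjoint_sdiff).mono_right hZR
  have hdis : Disjoint (S ∪ J) Z := Finset.disjoint_union_left.2 ⟨hSR.mono_right hZR', hJZ⟩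
  have hup := hQ (S ∪ J) Z hdis (by rw [Finset.card_union_of_disjoint hSJ, hJ]) hZ
  have hx : ∀ v, 0 ≤ blockWeight (S ∪ J) Z A B C v := by
    intro v; unfold blockWeight; split_ifs <;> linarith
  have hlow := sq_sub_sum_sq_le_nonadjWeight (G := G) (Y := P ∪ R) (f := fun v => decide (v ∈ P))
    hx (by
      intro u hu v hv huv
      rcases Finset.mem_union.1 hu with hu | hu <;> rcases Finset.mem_union.1 hv with hv | hv
      · simp [hu, hv]
      · exact (hadj u hu v hv huv).elim
      · exact (hadj v hv u hu huv.symm).elim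
      · simp [Finset.disjoint_right.1 hPR hu, Finset.disjoint_right.1 hPR hv])
  have hf₁ : (P ∪ R).filter (fun v => decide (v ∈ P) = true) = P := by
    ext v; simp only [Finset.mem_filter, Finset.mem_union, decide_eq_true_eq]; tauto
  have hf₂ : (P ∪ R).filter (fun v => decide (v ∈ P) = false) = R := by
    ext v
    have := fun hv : v ∈ R => Finset.disjoint_right.1 hPR hv
    simp only [Finset.mem_filter, Finset.mem_union, decide_eq_false_iff_not]; tauto
  rw [Fintype.sum_bool, hf₁, hf₂, Finset.sum_union hPR] at hlow
  have hwP : ∑ v ∈ P, blockWeight (S ∪ J) Z A B C v =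
      ((0 : ℕ) : ℝ) * A + ((0 : ℕ) : ℝ) * C + (P.card : ℝ) * B := by
    refine sum_blockWeight hdis A B C ?_ ?_ (by omega)
    · rw [Finset.card_eq_zero, ← Finset.disjoint_iff_inter_eq_empty]
      exact Finset.disjoint_union_right.2 ⟨hSP.symm, hPR.mono_right hJR⟩
    · rw [Finset.card_eq_zero, ← Finset.disjoint_iff_inter_eq_empty]
      exact hPR.mono_right hZR'
  have hwR : ∑ v ∈ R, blockWeight (S ∪ J) Z A B C v = j * A + t * C + h * B := by
    refine sum_blockWeight hdis A B C ?_ ?_ (by omega)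
    · rw [Finset.inter_union_distrib_left, Finset.disjoint_iff_inter_eq_empty.1 hSR.symm,
        Finset.empty_union, Finset.inter_eq_right.2 hJR, hJ]
    · rw [Finset.inter_eq_right.2 hZR', hZ]
  rw [hwP, hwR] at hlow
  push_cast at hlow hup
  have hBpos : 0 < B := hA.trans_le hAB
  have hlt' : (2 * t * h + 2 * t * t : ℝ) < P.card * (j + h) + 2 * t := by exact_mod_cast hlt
  have ht : (0 : ℝ) ≤ t * (t - 1) := by
    rcases Nat.eq_zero_or_pos t with h0 | h0
    · simp [h0]
    · have : (1 : ℝ) ≤ t := by exact_mod_cast h0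
      exact mul_nonneg (by linarith) (by linarith)
  -- The term `2 t |P| B C` occurs on both sides. The remaining terms are compared with multiples of
  -- `A B`, using `C ≤ 2A` and `A ≤ B`, which reduces the claim to `hlt`.
  have hAB0 : 0 < A * B := mul_pos hA hBpos
  have e₁ : C ^ 2 ≤ 4 * (A * B) := by nlinarith
  have e₂ : B * C ≤ 2 * (A * B) := by nlinarith
  have e₃ : A * B ≤ B * B := by nlinarith
  have f₁ := mul_le_mul_of_nonneg_left e₁ ht
  have f₂ := mul_le_mul_of_nonneg_left e₂ (by positivity : (0 : ℝ) ≤ t * h)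
  have f₃ := mul_le_mul_of_nonneg_left e₃ (by positivity : (0 : ℝ) ≤ P.card * h)
  have f₄ := mul_lt_mul_of_pos_right hlt' hAB0
  nlinarith

/-- Convexity: moving all surplus vertices, each of weight `B`, into a largest class increases the
sum of squares. The gain `E (2p + E) B²` is shared out as `e l (2p + E) B²` per class, and `2p + E ≥
e l + 4` once `e l ≥ 1`, which beats the loss because `a l < 2B`. -/
theorem sum_add_mul_sq_le {ι : Type*} (L : Finset ι) (e : ι → ℕ) (a : ι → ℝ) {B : ℝ} {p : ℕ}
    (hB : 0 < B) (hp : ∀ l ∈ L, e l + 1 ≤ p) (ha : ∀ l ∈ L, a l < 2 * B) :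
    ∑ l ∈ L, (a l + e l * B) ^ 2 + (p * B) ^ 2 ≤
        ∑ l ∈ L, a l ^ 2 + ((p + ∑ l ∈ L, e l : ℕ) * B) ^ 2 ∧
      ((∃ l ∈ L, 0 < e l) → ∑ l ∈ L, (a l + e l * B) ^ 2 + (p * B) ^ 2 <
        ∑ l ∈ L, a l ^ 2 + ((p + ∑ l ∈ L, e l : ℕ) * B) ^ 2) := by
  obtain ⟨E, hE⟩ : ∃ E, E = ∑ l ∈ L, e l := ⟨_, rfl⟩
  have hle : ∀ l ∈ L, e l ≤ E := fun l hl => hE ▸ Finset.single_le_sum (fun _ _ => Nat.zero_le _) hl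
  have hEr : (E : ℝ) = ∑ l ∈ L, (e l : ℝ) := by rw [hE]; push_cast; rfl
  have hlt : ∀ l ∈ L, 0 < e l → (a l + e l * B) ^ 2 < a l ^ 2 + e l * ((2 * p + E) * B ^ 2) := by
    intro l hl h0
    have h1 : (1 : ℝ) ≤ e l := by exact_mod_cast h0
    have h2 : (e l : ℝ) + 1 ≤ p := by exact_mod_cast hp l hl
    have h3 : (e l : ℝ) ≤ E := by exact_mod_cast hle l hl
    have h4 : 2 * a l + e l * B < (2 * p + E) * B := by nlinarith [ha l hl]
    have h5 : 0 < e l * B := by positivity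
    nlinarith [mul_lt_mul_of_pos_left h4 h5]
  have hle' : ∀ l ∈ L, (a l + e l * B) ^ 2 ≤ a l ^ 2 + e l * ((2 * p + E) * B ^ 2) := by
    intro l hl
    rcases Nat.eq_zero_or_pos (e l) with h0 | h0
    · simp [h0]
    · exact (hlt l hl h0).le
  have hsum : ∑ l ∈ L, (a l ^ 2 + e l * ((2 * p + E) * B ^ 2)) + (p * B) ^ 2 =
      ∑ l ∈ L, a l ^ 2 + ((p + E : ℕ) * B) ^ 2 := by
    rw [Finset.sum_add_distrib, ← Finset.sum_mul, ← hEr]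
    push_cast
    ring
  rw [← hE, ← hsum]
  refine ⟨by linarith [Finset.sum_le_sum hle'], ?_⟩
  rintro ⟨l, hl, h0⟩
  linarith [Finset.sum_lt_sum hle' ⟨l, hl, hlt l hl h0⟩]

/-- Weights for a separator `S` with at least `s` vertices: among the classes of `f` off `S`, at
least `t` of those different from `l₀` receive a vertex of weight `C`, and the sum of the squared
class weights is largest when all classes but `l₀` are singletons. -/
theorem exists_blockWeight_sum_sq_le {V ι : Type*} [Fintype V] [DecidableEq V] [Fintype ι]
    [DecidableEq ι] {Y : Finset V} {f : V → ι} (hne : ∀ l, ∃ v ∈ Y, f v = l) {l₀ : ι}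
    (hmax : ∀ l, (Y.filter fun v => f v = l).card ≤ (Y.filter fun v => f v = l₀).card)
    {s t g m : ℕ} (hs : s ≤ Yᶜ.card) (hι : Fintype.card ι = t + g + 1) (hY : Y.card = t + g + m)
    {A B C : ℝ} (hB : 0 < B) (hC : C < 2 * B) :
    ∃ Z₁ Z₃ : Finset V, Disjoint Z₁ Z₃ ∧ Z₁.card = s ∧ Z₃.card = t ∧
      ∑ v ∈ Y, blockWeight Z₁ Z₃ A B C v = t * C + (g + m) * B ∧
      ∑ l, (∑ v ∈ Y with f v = l, blockWeight Z₁ Z₃ A B C v) ^ 2 ≤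
        t * C ^ 2 + g * B ^ 2 + (m * B) ^ 2 ∧
      ((∃ l, l ≠ l₀ ∧ 1 < (Y.filter fun v => f v = l).card) →
        ∑ l, (∑ v ∈ Y with f v = l, blockWeight Z₁ Z₃ A B C v) ^ 2 <
          t * C ^ 2 + g * B ^ 2 + (m * B) ^ 2) := by
  choose r hrY hrf using hne
  have hL : (Finset.univ.erase l₀).card = t + g := by
    rw [Finset.card_erase_of_mem (Finset.mem_univ _), Finset.card_univ, hι]; rfl
  obtain ⟨Z₁, hZ₁Y, hZ₁⟩ := Finset.exists_subset_card_eq hs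
  obtain ⟨T, hTL, hT⟩ := Finset.exists_subset_card_eq (s := Finset.univ.erase l₀) (n := t)
    (by omega)
  have hl₀T : l₀ ∉ T := fun h => Finset.notMem_erase _ _ (hTL h)
  have hrinj : Function.Injective r := fun l l' h => by rw [← hrf l, ← hrf l', h]
  have hZ₃Y : T.image r ⊆ Y := Finset.image_subset_iff.2 fun l _ => hrY l
  have hYZ₁ : Disjoint Y Z₁ := (disjoint_compl_right (a := Y)).mono_right hZ₁Y
  have hdis : Disjoint Z₁ (T.image r) := (hYZ₁.mono_left hZ₃Y).symm
  have hZ₃ : (T.image r).card = t := by rw [Finset.card_image_of_injective _ hrinj, hT]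
  have hpos : ∀ l, 0 < (Y.filter fun v => f v = l).card := fun l =>
    Finset.card_pos.2 ⟨r l, Finset.mem_filter.2 ⟨hrY l, hrf l⟩⟩
  -- `e l` is the surplus of the class over its representative `r l`; for `l ∈ T` that
  -- representative is the vertex carrying `C`.
  obtain ⟨e, he⟩ : ∃ e : ι → ℕ, ∀ l, (Y.filter fun v => f v = l).card = e l + 1 :=
    ⟨fun l => (Y.filter fun v => f v = l).card - 1, fun l => (Nat.sub_add_cancel (hpos l)).symm⟩
  have hw : ∀ l, ∑ v ∈ Y with f v = l, blockWeight Z₁ (T.image r) A B C v =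
      (if l ∈ T then C else B) + e l * B := by
    intro l
    have h0 : ((Y.filter fun v => f v = l) ∩ Z₁).card = 0 := by
      rw [Finset.card_eq_zero, ← Finset.disjoint_iff_inter_eq_empty]
      exact hYZ₁.mono_left (Finset.filter_subset _ _)
    by_cases hl : l ∈ T
    · have h1 : ((Y.filter fun v => f v = l) ∩ T.image r).card = 1 := by
        rw [Finset.card_eq_one]
        refine ⟨r l, ?_⟩
        ext v
        simp only [Finset.mem_inter, Finset.mem_filter, Finset.mem_image, Finset.mem_singleton]
        constructor
        · rintro ⟨⟨_, hv⟩, l', _, rfl⟩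
          rw [hrf] at hv
          rw [hv]
        · rintro rfl
          exact ⟨⟨hrY l, hrf l⟩, l, hl, rfl⟩
      rw [sum_blockWeight hdis A B C h0 h1 (k := e l) (by rw [he]; omega), if_pos hl]
      push_cast
      ring
    · have h1 : ((Y.filter fun v => f v = l) ∩ T.image r).card = 0 := by
        rw [Finset.card_eq_zero, Finset.eq_empty_iff_forall_notMem]
        intro v
        simp only [Finset.mem_inter, Finset.mem_filter, Finset.mem_image]
        rintro ⟨⟨_, hv⟩, l', hl', rfl⟩
        rw [hrf] at hv
        exact hl (hv ▸ hl')
      rw [sum_blockWeight hdis A B C h0 h1 (k := e l + 1) (by rw [he]; omega), if_neg hl]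
      push_cast
      ring
  have hW : ∑ v ∈ Y, blockWeight Z₁ (T.image r) A B C v = t * C + (g + m) * B := by
    rw [sum_blockWeight hdis A B C (i := 0) (j := t) (k := g + m)]
    · push_cast
      ring
    · rw [Finset.card_eq_zero, ← Finset.disjoint_iff_inter_eq_empty]
      exact hYZ₁
    · rw [Finset.inter_eq_right.2 hZ₃Y, hZ₃]
    · omega
  have hsplit : ∑ l, (∑ v ∈ Y with f v = l, blockWeight Z₁ (T.image r) A B C v) ^ 2 =
      ∑ l ∈ Finset.univ.erase l₀, ((if l ∈ T then C else B) + e l * B) ^ 2 +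
        ((e l₀ + 1 : ℕ) * B) ^ 2 := by
    simp only [hw]
    rw [← Finset.sum_erase_add _ _ (Finset.mem_univ l₀), if_neg hl₀T]
    push_cast
    ring
  have hsq : ∑ l ∈ Finset.univ.erase l₀, (if l ∈ T then C else B) ^ 2 =
      t * C ^ 2 + g * B ^ 2 := by
    have h1 : (Finset.univ.erase l₀ \ T).card = g := by
      rw [Finset.card_sdiff_of_subset hTL]; omega
    rw [← Finset.sum_sdiff hTL, Finset.sum_congr rfl (g := fun _ => B ^ 2) fun l hl => by
      rw [if_neg (Finset.mem_sdiff.1 hl).2], Finset.sum_congr (s₁ := T) rfl (g := fun _ => C ^ 2)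
      fun l hl => by rw [if_pos hl]]
    simp [h1, hT, add_comm]
  have hm : e l₀ + 1 + ∑ l ∈ Finset.univ.erase l₀, e l = m := by
    have h1 : Y.card = ∑ l, (Y.filter fun v => f v = l).card :=
      Finset.card_eq_sum_card_fiberwise fun _ _ => by simp
    simp only [he] at h1
    rw [Finset.sum_add_distrib, ← Finset.sum_erase_add _ _ (Finset.mem_univ l₀)] at h1
    simp only [Finset.sum_const, Finset.card_univ, hι, smul_eq_mul, mul_one] at h1
    omega
  have key := sum_add_mul_sq_le (Finset.univ.erase l₀) e (fun l => if l ∈ T then C else B)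
    (p := e l₀ + 1) hB (fun l _ => by rw [← he, ← he]; exact hmax l)
    (fun l _ => by
      split_ifs <;> linarith)
  rw [hm, hsq] at key
  refine ⟨Z₁, T.image r, hdis, hZ₁, hZ₃, hW, ?_, ?_⟩
  · rw [hsplit]
    exact key.1
  · rintro ⟨l, hl, hl1⟩
    rw [hsplit]
    refine key.2 ⟨l, Finset.mem_erase.2 ⟨hl, Finset.mem_univ l⟩, ?_⟩
    rw [he] at hl1
    omega

/-! ### Separators, connectivity and minimum degree. -/

/-- The separator is the bad `k`-set `X` together with the set found in `G - X`, whose order is even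
because `n ≡ k`. Labels on `X` are irrelevant. -/
theorem exists_separator_of_not_isKCriticalOddFactor {V : Type*} [Fintype V] {G : SimpleGraph V}
    {b k : ℕ} (hb : Odd b) (hcard : k + 2 ≤ Fintype.card V)
    (hpar : Fintype.card V ≡ k [MOD 2]) (hG : ¬ IsKCriticalOddFactor G k b) :
    ∃ (S : Finset V) (r : ℕ) (f : V → Fin (b * r + 2)), S.card = k + r ∧
      (∀ u ∉ S, ∀ v ∉ S, G.Adj u v → f u = f v) ∧ ∀ l, ∃ v ∉ S, f v = l := by
  classical
  obtain ⟨X, hX, hno⟩ : ∃ X : Finset V, X.card = k ∧ ¬ HasOddFactor (G.induce {v | v ∉ X}) b := by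
    by_contra! h
    exact hG ⟨hcard, h⟩
  have hev : Even (Fintype.card {v | v ∉ X}) := by
    have h1 : Fintype.card {v | v ∉ X} = Fintype.card V - k := by
      rw [← hX, ← Finset.card_compl, ← Fintype.card_coe]
      exact Fintype.card_congr (Equiv.subtypeEquivRight fun v => by simp)
    rw [h1, Nat.even_iff]
    rw [Nat.ModEq] at hpar
    omega
  obtain ⟨S, f, hf, hsurj⟩ := exists_many_components_of_not_hasOddFactor hb hev hno
  have hmem : ∀ v (hv : v ∉ X), v ∈ X ∪ S.map ⟨Subtype.val, Subtype.val_injective⟩ ↔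
      (⟨v, hv⟩ : {v | v ∉ X}) ∈ S := by
    intro v hv
    simp only [Finset.mem_union, hv, false_or, Finset.mem_map, Function.Embedding.coeFn_mk]
    constructor
    · rintro ⟨w, hw, rfl⟩
      exact hw
    · intro h
      exact ⟨_, h, rfl⟩
  refine ⟨X ∪ S.map ⟨Subtype.val, Subtype.val_injective⟩, S.card,
    fun v => if hv : v ∉ X then f ⟨v, hv⟩ else 0, ?_, ?_, ?_⟩
  · rw [Finset.card_union_of_disjoint, Finset.card_map, hX]
    rw [Finset.disjoint_right]
    intro v hv
    obtain ⟨w, _, rfl⟩ := Finset.mem_map.1 hv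
    exact w.2
  · intro u hu v hv huv
    have hu' : u ∉ X := fun h => hu (Finset.mem_union_left _ h)
    have hv' : v ∉ X := fun h => hv (Finset.mem_union_left _ h)
    simp only [hu', hv', not_false_eq_true, dif_pos]
    exact hf _ _ (fun h => hu ((hmem u hu').2 h)) (fun h => hv ((hmem v hv').2 h)) huv
  · intro l
    obtain ⟨⟨v, hv⟩, hvS, hl⟩ := hsurj l
    refine ⟨v, fun h => hvS ((hmem v hv).1 h), ?_⟩
    have hv' : v ∉ X := hv
    simp only [hv', not_false_eq_true, dif_pos]
    exact hl

theorem SimpleGraph.Connected.eq_of_locally_constant {V ι : Type*} {G : SimpleGraph V}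
    (hG : G.Connected) {f : V → ι} (hf : ∀ u v, G.Adj u v → f u = f v) (u v : V) : f u = f v := by
  obtain ⟨p⟩ := hG.preconnected u v
  induction p with
  | nil => rfl
  | cons h _ ih => exact (hf _ _ h).trans ih

theorem IsKConnected.connected {V : Type*} [Fintype V] {G : SimpleGraph V} {k : ℕ} (hk : 0 < k)
    (hG : IsKConnected G k) : G.Connected := by
  have h := hG.2 ∅ (by simpa using hk)
  have hu : {v : V | v ∉ (∅ : Finset V)} = Set.univ := by ext; simp
  rw [hu] at h
  exact (SimpleGraph.induceUnivIso G).connected_iff.1 h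

theorem IsKConnected.eq_of_card_lt {V ι : Type*} [Fintype V] {G : SimpleGraph V} {k : ℕ}
    (hG : IsKConnected G k) {S : Finset V} (hS : S.card < k) {f : V → ι}
    (hf : ∀ u ∉ S, ∀ v ∉ S, G.Adj u v → f u = f v) {u v : V} (hu : u ∉ S) (hv : v ∉ S) :
    f u = f v :=
  (hG.2 S hS).eq_of_locally_constant (f := fun w : {v | v ∉ S} => f w)
    (fun a b h => hf a a.2 b b.2 h) ⟨u, hu⟩ ⟨v, hv⟩

/-- Deleting the neighbourhood of a vertex of degree below `k` would isolate it from another vertex,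
which exists since the order exceeds `k`. -/
theorem IsKConnected.le_minDegree {V : Type*} [Fintype V] {G : SimpleGraph V} [DecidableRel G.Adj]
    {k : ℕ} (hG : IsKConnected G k) : k ≤ G.minDegree := by
  classical
  by_contra! hlt
  have : Nonempty V := Fintype.card_pos_iff.1 (Nat.zero_lt_of_lt hG.1)
  obtain ⟨v, hv⟩ := G.exists_minimal_degree_vertex
  have hvN : v ∉ G.neighborFinset v := by simp
  obtain ⟨w, hw⟩ : ∃ w, w ∉ insert v (G.neighborFinset v) := by
    by_contra! h
    have h1 : (insert v (G.neighborFinset v)).card = Fintype.card V := by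
      rw [Finset.eq_univ_iff_forall.2 h, Finset.card_univ]
    have h2 := hG.1
    rw [Finset.card_insert_of_notMem hvN, SimpleGraph.card_neighborFinset_eq_degree] at h1
    omega
  rw [Finset.mem_insert, not_or] at hw
  have h := hG.eq_of_card_lt (S := G.neighborFinset v) (f := fun u => u = v)
    (by rw [SimpleGraph.card_neighborFinset_eq_degree]; omega) (by
      intro a ha c hc hac
      rw [SimpleGraph.mem_neighborFinset] at ha hc
      have h1 : a ≠ v := by rintro rfl; exact hc hac
      have h2 : c ≠ v := by rintro rfl; exact ha hac.symm
      simp [h1, h2]) hvN hw.2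
  exact hw.1 (Eq.mp h rfl)

/-- A vertex of the class and all its neighbours lie in `S` or in the class. -/
theorem minDegree_lt_card_add_card_class {V ι : Type*} [Fintype V] [DecidableEq V] [DecidableEq ι]
    {G : SimpleGraph V} [DecidableRel G.Adj] {S : Finset V} {f : V → ι}
    (hf : ∀ u ∉ S, ∀ v ∉ S, G.Adj u v → f u = f v) {l : ι} (hl : ∃ v ∉ S, f v = l) :
    G.minDegree < S.card + (Sᶜ.filter fun v => f v = l).card := by
  obtain ⟨v, hv, rfl⟩ := hl
  have hsub : insert v (G.neighborFinset v) ⊆ S ∪ Sᶜ.filter fun u => f u = f v := by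
    intro u hu
    simp only [Finset.mem_insert, SimpleGraph.mem_neighborFinset, Finset.mem_union,
      Finset.mem_filter, Finset.mem_compl] at hu ⊢
    by_cases huS : u ∈ S
    · exact Or.inl huS
    · refine Or.inr ⟨huS, ?_⟩
      rcases hu with rfl | hu
      · rfl
      · exact (hf v hv u huS hu).symm
  have h1 := (Finset.card_le_card hsub).trans (Finset.card_union_le _ _)
  rw [Finset.card_insert_of_notMem (by simp), SimpleGraph.card_neighborFinset_eq_degree] at h1
  have h2 := G.minDegree_le_degree v
  omega

/-! ### Numerical consequences of the bound on `n`. -/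

/-- Serves the case `0 < r < d`, whence `d ≥ 2`. The hypothesis is `(2/3) b² (k + d)² (d + 3k) ≤ n`,
and `d + 3k ≥ 5`. -/
theorem lt_of_cubic_bound {b k d n : ℕ} (hb : 0 < b) (hk : 0 < k) (hd : 2 ≤ d)
    (h : 2 / 3 * (b : ℝ) ^ 2 * ((k + d : ℕ) : ℝ) ^ 3 +
      4 / 3 * (b : ℝ) ^ 2 * k * ((k + d : ℕ) : ℝ) ^ 2 ≤ n) :
    k + d + 2 * (b * d + 1) ^ 2 < n := by
  have hb' : (1 : ℝ) ≤ b := by exact_mod_cast hb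
  have hk' : (1 : ℝ) ≤ k := by exact_mod_cast hk
  have hd' : (2 : ℝ) ≤ d := by exact_mod_cast hd
  have hb2 : (1 : ℝ) ≤ (b : ℝ) ^ 2 := by nlinarith
  push_cast at h
  have h1 : (k + d + 2 * (b * d + 1) ^ 2 : ℝ) ≤ b ^ 2 * (k + d + 2 * (d + 1) ^ 2) := by
    have e1 : (b * d + 1 : ℝ) ≤ b * (d + 1) := by nlinarith
    have e2 : (b * d + 1 : ℝ) ^ 2 ≤ (b * (d + 1)) ^ 2 := pow_le_pow_left₀ (by positivity) e1 2
    nlinarith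
  have h2 : (k + d + 2 * (d + 1) ^ 2 : ℝ) < 2 / 3 * (k + d) ^ 2 * (d + 3 * k) := by
    have e1 : (5 : ℝ) ≤ d + 3 * k := by linarith
    have e2 : (10 / 3 * (k + d) ^ 2 : ℝ) ≤ 2 / 3 * (k + d) ^ 2 * (d + 3 * k) := by
      nlinarith [sq_nonneg ((k : ℝ) + d)]
    nlinarith
  have h3 : (b ^ 2 * (k + d + 2 * (d + 1) ^ 2) : ℝ) <
      b ^ 2 * (2 / 3 * (k + d) ^ 2 * (d + 3 * k)) := by
    have : (0 : ℝ) < b ^ 2 := by linarith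
    exact mul_lt_mul_of_pos_left h2 this
  have h4 : (k + d + 2 * (b * d + 1) ^ 2 : ℝ) < n := by nlinarith
  exact_mod_cast h4

/-- Serves the case `r ≥ d`, where it says `m ≥ 8d + 7`. -/
theorem le_of_linear_bound {b k d n : ℕ} (hb : 0 < b) (hk : 0 < k) (hd : 1 ≤ d)
    (h : (2 * (b : ℝ) ^ 2 + 3 * b + 11) * ((k + d : ℕ) : ℝ)
      - (2 * (b : ℝ) ^ 2 + 5 / 2 * b + 3 / 2) * k + 3 / 2 * b + 2 + 3 / (2 * (b : ℝ)) ≤ n) :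
    k + d + (b * d + 1) + 8 * d + 7 ≤ n := by
  have hb' : (1 : ℝ) ≤ b := by exact_mod_cast hb
  have hk' : (1 : ℝ) ≤ k := by exact_mod_cast hk
  have hd' : (1 : ℝ) ≤ d := by exact_mod_cast hd
  have h0 : (0 : ℝ) ≤ 3 / (2 * (b : ℝ)) := by positivity
  push_cast at h
  have h4 : (k + d + (b * d + 1) + 8 * d + 7 : ℝ) ≤ n := by
    nlinarith [mul_nonneg (sub_nonneg.2 hb') (sub_nonneg.2 hd'),
      mul_nonneg (sub_nonneg.2 hb') (sub_nonneg.2 hk'),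
      mul_nonneg (sq_nonneg (b : ℝ)) (sub_nonneg.2 hd')]
  exact_mod_cast h4

/-! ### The two cases and the conclusion. -/

/-- With the weights of the Perron vector of `K_{k+d} ∨ (K_m ∪ t K₁)`, `t = b d + 1`, a separator
with fewer than `k + d` vertices leaves too few components. -/
theorem false_of_small_separator {V : Type*} [Fintype V] [DecidableEq V] {G : SimpleGraph V}
    [DecidableRel G.Adj] {b k d r m t : ℕ} (hb : 0 < b) (hδ : G.minDegree = k + d)
    (ht : t = b * d + 1) (hm : Fintype.card V = k + d + t + m)
    (hn : k + d + 2 * t ^ 2 < Fintype.card V) {S : Finset V} (hS : S.card = k + r) (hr : 0 < r)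
    (hrd : r < d) {f : V → Fin (b * r + 2)} (hf : ∀ u ∉ S, ∀ v ∉ S, G.Adj u v → f u = f v)
    (hsurj : ∀ l, ∃ v ∉ S, f v = l) {A B C : ℝ} (hA : 0 < A) (hAB : A ≤ B) (hC : 0 < C)
    (hCA : C ≤ 2 * A)
    (hQ : ∀ Z₁ Z₃ : Finset V, Disjoint Z₁ Z₃ → Z₁.card = k + d → Z₃.card = t →
      nonadjWeight G (blockWeight Z₁ Z₃ A B C) ≤ 2 * t * m * B * C + t * (t - 1) * C ^ 2) :
    False := by
  obtain ⟨j, rfl⟩ : ∃ j, d = r + j := ⟨d - r, by omega⟩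
  have hj : 0 < j := by omega
  obtain ⟨l₀, -, hmax⟩ := Finset.exists_max_image (Finset.univ : Finset (Fin (b * r + 2)))
    (fun l => (Sᶜ.filter fun v => f v = l).card) ⟨0, Finset.mem_univ 0⟩
  set P := Sᶜ.filter fun v => f v = l₀ with hP
  set R := Sᶜ.filter fun v => ¬ f v = l₀ with hR
  have hPR : P.card + R.card = Sᶜ.card := Finset.card_filter_add_card_filter_not _
  have hSc : Sᶜ.card = Fintype.card V - S.card := Finset.card_compl S
  have hsum : Sᶜ.card = ∑ l, (Sᶜ.filter fun v => f v = l).card :=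
    Finset.card_eq_sum_card_fiberwise fun _ _ => by simp
  have hclass : ∀ l, j + 1 ≤ (Sᶜ.filter fun v => f v = l).card := by
    intro l
    have := minDegree_lt_card_add_card_class hf (hsurj l)
    omega
  have hRcard : (b * r + 1) * (j + 1) ≤ R.card := by
    have h1 : R.card = ∑ l ∈ Finset.univ.erase l₀, (Sᶜ.filter fun v => f v = l).card := by
      rw [← Finset.sum_erase_add _ _ (Finset.mem_univ l₀), ← hP] at hsum
      omega
    rw [h1]
    have h2 := Finset.card_nsmul_le_sum (Finset.univ.erase l₀)
      (fun l => (Sᶜ.filter fun v => f v = l).card) (j + 1) fun l _ => hclass l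
    rw [Finset.card_erase_of_mem (Finset.mem_univ _), Finset.card_univ, Fintype.card_fin] at h2
    simpa using h2
  have hPcard : Sᶜ.card ≤ (b * r + 2) * P.card := by
    rw [hsum]
    have h2 := Finset.sum_le_card_nsmul Finset.univ
      (fun l => (Sᶜ.filter fun v => f v = l).card) P.card hmax
    simpa using h2
  -- There are at most `t` classes, so the largest has more than `2t` of the more than `2t²`
  -- vertices off `S`.
  have hqt : b * r + 2 ≤ t := by rw [ht]; nlinarith
  have hp : 2 * t < P.card := by
    have h1 : (b * r + 2) * P.card ≤ t * P.card := Nat.mul_le_mul_right _ hqt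
    have h2 : t * (2 * t) < t * P.card := by
      have h3 : 2 * t ^ 2 = t * (2 * t) := by ring
      have h4 := Finset.card_le_univ S
      omega
    exact Nat.lt_of_mul_lt_mul_left h2
  -- `(b r + 1)(j + 1) ≥ b (r + j) + 1 + j` amounts to `b r j ≥ b j`, which needs `r ≥ 1`.
  have hRt : t + j ≤ R.card := by
    rw [ht]
    have : b * j ≤ b * r * j := by nlinarith [Nat.mul_le_mul_left (b * j) hr]
    nlinarith
  obtain ⟨h, hh⟩ : ∃ h, R.card = t + j + h := ⟨R.card - (t + j), by omega⟩
  have hmh : m = P.card + h := by omega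
  -- Combine `|P| h ≥ 2 t h + h` and `|P| j ≥ |P|` with `|P| + h + t > 2t²`, which comes from
  -- counting the vertices off `S`.
  have hlt : 2 * t * h + 2 * t * t < P.card * (j + h) + 2 * t := by
    have h1 : P.card * (j + h) = P.card * j + P.card * h := by ring
    have h2 : (2 * t + 1) * h ≤ P.card * h := Nat.mul_le_mul_right _ hp
    have h3 : P.card * 1 ≤ P.card * j := Nat.mul_le_mul_left _ hj
    have h4 : 2 * t ^ 2 = 2 * t * t := by ring
    nlinarith
  have hSd : Disjoint S Sᶜ := disjoint_compl_right
  refine false_of_nonadjWeight_le_of_two_sides (G := G) (S := S) (P := P) (R := R)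
    (hSd.mono_right (Finset.filter_subset _ _)) (hSd.mono_right (Finset.filter_subset _ _))
    (Finset.disjoint_filter_filter_not _ _ _) ?_ hh hlt hA hAB hC hCA ?_
  · intro u hu v hv huv
    simp only [hP, hR, Finset.mem_filter, Finset.mem_compl] at hu hv
    exact hv.2 (hu.2 ▸ (hf u hu.1 v hv.1 huv).symm)
  · intro Z₁ Z₃ hZ h₁ h₃
    rw [← hmh]
    exact hQ Z₁ Z₃ hZ (by omega) h₃

/-- With the weights of the Perron vector of `K_{k+d} ∨ (K_m ∪ t K₁)`, `t = b d + 1`, a separator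
with at least `k + d` vertices leaves too few components, except in that graph itself. -/
theorem nonempty_iso_of_large_separator {V : Type*} [Fintype V] [DecidableEq V] {G : SimpleGraph V}
    {b k d r m t : ℕ} (hb : 0 < b)
    (ht : t = b * d + 1) (hm : Fintype.card V = k + d + t + m)
    (hn : 8 * d + 7 ≤ m) {S : Finset V} (hS : S.card = k + r)
    (hrd : d ≤ r) {f : V → Fin (b * r + 2)} (hf : ∀ u ∉ S, ∀ v ∉ S, G.Adj u v → f u = f v)
    (hsurj : ∀ l, ∃ v ∉ S, f v = l) {A B C : ℝ} (hA : 0 < A) (hAB : A < B) (hC : 0 < C)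
    (hCA : C ≤ 2 * A)
    (hQ : ∀ Z₁ Z₃ : Finset V, Disjoint Z₁ Z₃ → Z₁.card = k + d → Z₃.card = t →
      nonadjWeight G (blockWeight Z₁ Z₃ A B C) ≤ 2 * t * m * B * C + t * (t - 1) * C ^ 2) :
    Nonempty (G ≃g joinGraph (k + d) m t) := by
  obtain ⟨i, rfl⟩ : ∃ i, r = d + i := ⟨r - d, by omega⟩
  have hB : 0 < B := hA.trans hAB
  have hCB : C < 2 * B := by linarith
  obtain ⟨l₀, -, hmax⟩ := Finset.exists_max_image (Finset.univ : Finset (Fin (b * (d + i) + 2)))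
    (fun l => (Sᶜ.filter fun v => f v = l).card) ⟨0, Finset.mem_univ 0⟩
  have hSc : Sᶜ.card = Fintype.card V - S.card := Finset.card_compl S
  have hsum : Sᶜ.card = ∑ l, (Sᶜ.filter fun v => f v = l).card :=
    Finset.card_eq_sum_card_fiberwise fun _ _ => by simp
  have hsurj' : ∀ l, ∃ v ∈ Sᶜ, f v = l := by simpa using hsurj
  have hclass : ∀ l, 1 ≤ (Sᶜ.filter fun v => f v = l).card := by
    intro l
    obtain ⟨v, hv, hl⟩ := hsurj' l
    exact Finset.card_pos.2 ⟨v, Finset.mem_filter.2 ⟨hv, hl⟩⟩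
  have hq : b * (d + i) + 2 = t + b * i + 1 := by rw [ht]; ring
  have hle : t + b * i + 1 ≤ Sᶜ.card := by
    have h := Finset.card_nsmul_le_sum Finset.univ
      (fun l => (Sᶜ.filter fun v => f v = l).card) 1 fun l _ => hclass l
    rw [← hsum, Finset.card_univ, Fintype.card_fin] at h
    simp only [smul_eq_mul, mul_one] at h
    omega
  obtain ⟨m', hm'⟩ : ∃ m', Sᶜ.card = t + b * i + m' := ⟨Sᶜ.card - (t + b * i), by omega⟩
  have hm1 : 1 ≤ m' := by omega
  -- The `B` block consists of `i` spare vertices of `S`, `b i` that stand for singleton classes,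
  -- and `m'` for the big class.
  have hmm : m = m' + i + b * i := by omega
  have hSle : S.card ≤ Fintype.card V := Finset.card_le_univ S
  obtain ⟨Z₁, Z₃, hZ, h₁, h₃, hW, hle', hlt'⟩ := exists_blockWeight_sum_sq_le (f := f)
    (Y := Sᶜ) hsurj' (fun l => hmax l (Finset.mem_univ l)) (s := k + d) (t := t) (g := b * i)
    (m := m') (by rw [compl_compl]; omega) (by rw [Fintype.card_fin, hq]) hm' (A := A) hB hCB
  have hx : ∀ v, 0 < blockWeight Z₁ Z₃ A B C v := by
    intro v; unfold blockWeight; split_ifs <;> assumption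
  have hf' : ∀ u ∈ Sᶜ, ∀ v ∈ Sᶜ, G.Adj u v → f u = f v := by simpa using hf
  have hup := hQ Z₁ Z₃ hZ h₁ h₃
  have hlow := sq_sub_sum_sq_le_nonadjWeight (fun v => (hx v).le) hf'
  rw [hW] at hlow
  have hmr : (m : ℝ) = m' + i + b * i := by rw [hmm]; push_cast; rfl
  rw [hmr] at hup
  push_cast at hlow hle' hlt'
  rcases Nat.eq_zero_or_pos i with rfl | hi
  -- For `i = 0` the lower and upper bounds on the nonadjacent weight coincide. Hence all classes
  -- but `l₀` are singletons, and nonadjacent pairs are exactly the cross pairs.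
  · simp only [Nat.cast_zero, mul_zero, add_zero, zero_add, zero_mul] at *
    have hone : ∀ l, l ≠ l₀ → (Sᶜ.filter fun v => f v = l).card = 1 := by
      intro l hl
      by_contra hne
      have h1 := hclass l
      have h2 := hlt' ⟨l, hl, by omega⟩
      nlinarith
    have hadj : ∀ u v, u ≠ v → ¬ G.Adj u v → u ∈ Sᶜ ∧ v ∈ Sᶜ ∧ f u ≠ f v := by
      intro u v huv hnadj
      by_contra hno
      have h2 := sq_sub_sum_sq_lt_nonadjWeight hx hf' huv hnadj hno
      rw [hW] at h2
      nlinarith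
    set P := Sᶜ.filter fun v => f v = l₀ with hP
    set R := Sᶜ.filter fun v => ¬ f v = l₀ with hR
    have hPR : P.card + R.card = Sᶜ.card := Finset.card_filter_add_card_filter_not _
    have hRc : R.card = t := by
      rw [← Finset.sum_erase_add _ _ (Finset.mem_univ l₀), ← hP,
        Finset.sum_congr rfl fun l hl => hone l (Finset.ne_of_mem_erase hl)] at hsum
      rw [Finset.sum_const, Finset.card_erase_of_mem (Finset.mem_univ _), Finset.card_univ,
        Fintype.card_fin, smul_eq_mul, mul_one, add_zero] at hsum
      omega
    have hSd : Disjoint S Sᶜ := disjoint_compl_right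
    refine nonempty_iso_joinGraph (S := S) (P := P) (Z := R)
      (hSd.mono_right (Finset.filter_subset _ _)) (hSd.mono_right (Finset.filter_subset _ _))
      (Finset.disjoint_filter_filter_not _ _ _) hS (by omega) hRc (by omega) ?_
    intro u v
    constructor
    · intro huv
      refine ⟨huv.ne, ?_⟩
      by_cases hu : u ∈ S
      · exact Or.inl hu
      by_cases hv : v ∈ S
      · exact Or.inr (Or.inl hv)
      refine Or.inr (Or.inr ?_)
      have hfe := hf u hu v hv huv
      have hl : f u = l₀ := by
        by_contra hl
        have hc := Finset.card_le_one.1 (hone (f u) hl).le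
        exact huv.ne (hc u (by simp [hu]) v (by simp [hv, hfe]))
      exact ⟨by simp [hP, hu, hl], by simp [hP, hv, ← hfe, hl]⟩
    · rintro ⟨hne, h⟩
      by_contra hno
      obtain ⟨hu, hv, hfe⟩ := hadj u v hne hno
      rw [Finset.mem_compl] at hu hv
      rcases h with h | h | ⟨h, h'⟩
      · exact hu h
      · exact hv h
      · exact hfe ((Finset.mem_filter.1 h).2.trans (Finset.mem_filter.1 h').2.symm)
  · exfalso
    -- Cancelling common terms leaves `b i (b i + 2m' - 1) B² ≤ 2 t i B C < 4 t i B²`, which this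
    -- inequality refutes. It follows from `m ≥ 8d + 7` and `m' ≥ 1`.
    have hkey : 4 * t + b ≤ b * (b * i + 2 * m') := by
      have h1 : i ≤ b * i := Nat.le_mul_of_pos_left i hb
      have h2 : 8 * d + 10 ≤ 2 * (b * i + 2 * m') := by omega
      have h3 := Nat.mul_le_mul_left b h2
      rw [ht]
      nlinarith
    have hkey' : (4 * t + b : ℝ) ≤ b * (b * i + 2 * m') := by exact_mod_cast hkey
    have hi' : (0 : ℝ) < i := by exact_mod_cast hi
    have htr : (0 : ℝ) < t := by rw [ht]; positivity
    have e₁ : (i : ℝ) * B ^ 2 * (4 * t + b) ≤ i * B ^ 2 * (b * (b * i + 2 * m')) :=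
      mul_le_mul_of_nonneg_left hkey' (by positivity)
    have e₂ : (2 * t * i * B) * C < (2 * t * i * B) * (2 * B) :=
      mul_lt_mul_of_pos_left hCB (by positivity)
    nlinarith

theorem theorem1p5 {V : Type*} [Fintype V] [DecidableEq V]
    (G : SimpleGraph V) [DecidableRel G.Adj] (b k n δ : ℕ)
    (hb : 0 < b) (hk : 0 < k) (hn : 0 < n)
    (hnk : n ≡ k [MOD 2]) (hbodd : Odd b)
    (hcard : Fintype.card V = n)
    (hconn : IsKConnected G (k + 1))
    (hδ : G.minDegree = δ)
    (hbound : max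
        ((2 * (b : ℝ) ^ 2 + 3 * b + 11) * δ - (2 * (b : ℝ) ^ 2 + 5 / 2 * b + 3 / 2) * k
          + 3 / 2 * b + 2 + 3 / (2 * (b : ℝ)))
        (2 / 3 * (b : ℝ) ^ 2 * (δ : ℝ) ^ 3 + 4 / 3 * (b : ℝ) ^ 2 * k * (δ : ℝ) ^ 2) ≤ (n : ℝ))
    (hμ : distSpectralRadius G ≤ distSpectralRadius (extremalGraph n b k δ)) :
    IsKCriticalOddFactor G k b ∨ Nonempty (G ≃g extremalGraph n b k δ) := by
  by_contra! hno
  obtain ⟨hcrit, hiso⟩ := hno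
  obtain ⟨hlin, hcub⟩ := max_le_iff.1 hbound
  obtain ⟨d, rfl⟩ : ∃ d, δ = k + d := ⟨δ - k, by have := hconn.le_minDegree; omega⟩
  have hd : 1 ≤ d := by have := hconn.le_minDegree; omega
  have hlin' := le_of_linear_bound hb hk hd hlin
  obtain ⟨t, ht⟩ : ∃ t, t = b * d + 1 := ⟨_, rfl⟩
  obtain ⟨m, hm⟩ : ∃ m, n = k + d + t + m := ⟨n - (k + d + t), by omega⟩
  have ht' : b * (k + d) - b * k + 1 = t := by
    rw [ht, Nat.mul_add, Nat.add_sub_cancel_left]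
  have hm' : n + b * k - (b + 1) * (k + d) - 1 = m := by
    have : (b + 1) * (k + d) = b * k + b * d + k + d := by ring
    omega
  unfold extremalGraph at hμ hiso
  rw [ht', hm'] at hμ hiso
  obtain ⟨A, B, C, hA, hAB, hC, hCA, h₁, h₂, h₃⟩ :=
    exists_joinGraph_eigenvalue_equations (s := k + d) (m := m) (t := t) (by omega)
  -- The first two equations differ by `t C`, and `t ≥ 1`.
  have hAB' : A < B := by
    refine hAB.lt_of_ne ?_
    rintro rfl
    have : (0 : ℝ) < t * C := mul_pos (by exact_mod_cast (by omega : 0 < t)) hC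
    linarith
  have hB : 0 < B := hA.trans hAB'
  have hG : G.Connected := hconn.connected (Nat.succ_pos k)
  have hQ : ∀ Z₁ Z₃ : Finset V, Disjoint Z₁ Z₃ → Z₁.card = k + d → Z₃.card = t →
      nonadjWeight G (blockWeight Z₁ Z₃ A B C) ≤ 2 * t * m * B * C + t * (t - 1) * C ^ 2 :=
    fun Z₁ Z₃ hZ hZ₁ hZ₃ => nonadjWeight_blockWeight_le hG (hcard.trans hm) hA.le hB.le hC.le
      h₁ h₂ h₃ hμ hZ hZ₁ hZ₃
  obtain ⟨S, r, f, hS, hf, hsurj⟩ := exists_separator_of_not_isKCriticalOddFactor hbodd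
    hconn.1 (hcard ▸ hnk) hcrit
  rcases Nat.lt_or_ge r d with hrd | hrd
  -- If `r = 0`, then `S` has only `k` vertices yet separates two classes, against `(k +
  -- 1)`-connectedness.
  · have hr : 0 < r := by
      by_contra hr
      obtain ⟨u, hu, hfu⟩ := hsurj 0
      obtain ⟨v, hv, hfv⟩ := hsurj 1
      have := hconn.eq_of_card_lt (by omega) hf hu hv
      rw [hfu, hfv] at this
      exact absurd this (by simp)
    refine false_of_small_separator hb hδ ht (hcard.trans hm) ?_ hS hr hrd hf hsurj hA hAB hC
      hCA hQ
    rw [hcard, ht]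
    exact lt_of_cubic_bound hb hk (by omega) hcub
  · exact not_nonempty_iff.2 hiso (nonempty_iso_of_large_separator hb ht (hcard.trans hm) (by omega) hS hrd hf
      hsurj hA hAB' hC hCA hQ)
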